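/- Let $q \ge 3$ be a prime power and $n = q^2-1$. An $[[n,k,d]]_q$ quantum code is a subspace $Q \subseteq (\mathbb{C}^q)^{\otimes n}$ of dimension $q^k$ whose minimum distance is $d$, i.e. $d$ is the least number $w$ for which there are $w$ of the $n$ qudits and an operator $E$ acting only on these such that $PEP$ is not a scalar multiple of $P$, where $P$ is the orthogonal projection onto $Q$. Then there exists an $[[\,q^2-1,\ q^2-4q+5,\ d\,]]_q$ quantum code with $d \ge q$. Such a code comes from the CSS construction applied to BCH codes, as follows. For $s \ge 0$ let $\mathbb{C}_s = \{ s q^j \bmod n : j \ge 0\} \subseteq \{0,\dots,n-1\}$ be the $q$-coset of $s$ modulo $n$. The $2q-2$ cosets $$\mathbb{C}_0=\{0\},\quad \mathbb{C}_i=\{i,\,iq\}\ (1\le i\le q-2),\quad \mathbb{C}_{q+1}=\{q+1\},\quad \mathbb{C}_{q+l}=\{q+l,\,1+lq\}\ (2\le l\le q-1)$$ are as displayed and are pairwise disjoint, and all of them except $\mathbb{C}_0$ and $\mathbb{C}_{q+1}$ have exactly two elements. Let $\alpha$ be any primitive element of $\mathbb{F}_{q^2}$, and let $M^{(i)}(x)$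 be the minimal polynomial of $\alpha^i$ over $\mathbb{F}_q$. Let $C_1$ be the BCH code of length $n$ over $\mathbb{F}_q$ generated by $\operatorname{lcm}\{M^{(0)},\dots,M^{(q-2)}\}$, let $C$ be the BCH code generated by $\operatorname{lcm}\{M^{(q+1)},\dots,M^{(2q-1)}\}$, and let $C_2$ be the cyclic code generated by the product of all distinct minimal polynomials $M^{(i)}$, $0\le i<n$, other than $M^{(q+1)},\dots,M^{(2q-1)}$. Then: 1. for $0\le t<n$, $\alpha^t$ is a zero of the generator polynomial of $C_1$ if and only if $t\in\bigcup_{i=0}^{q-2}\mathbb{C}_i$, and a zero of the generator polynomial of $C$ if and only if $t\in\bigcup_{i=q+1}^{2q-1}\mathbb{C}_i$; 2. the Euclidean dual $C_2^\perp$ is equivalent to $C$: it consists of the words of $C$ read backwards; 3. $C_2\subseteq C_1$, and the CSS code of $C_1$ and $C_2$, that is, the span in $(\mathbb{C}^q)^{\otimes n}$ (with basis $|y\rangle$, $y\in\mathbb{F}_q^n$) of the vectors $\sum_{c\in C_2}|x+c\rangle$, $x\in C_1$, is a $[[\,q^2-1,\ q^2-4q+5,\ d\,]]_q$ quantum code with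 $d\ge q$. -/

import Mathlib

open Polynomial

noncomputable section

namespace QBCH

/-! ### Cyclotomic cosets -/

/-- The `q`-coset modulo `n` containing `s`: the residues of `s, sq, sq², …` in `{0, …, n - 1}`. -/
def qCoset (q n s : ℕ) : Set ℕ := {t | ∃ j : ℕ, t = s * q ^ j % n}

/-! ### Classical codes -/

/-- The polynomial `c₀ + c₁ X + ⋯ + c_{n-1} X^{n-1}` of the word `c`. -/
def wordPoly {F : Type*} [Field F] {n : ℕ} (c : Fin n → F) : F[X] :=
  ∑ i : Fin n, C (c i) * X ^ (i : ℕ)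

/-- The cyclic code of length `n` with generator polynomial `g` (where `g ∣ X ^ n - 1`): the words
whose polynomial is a multiple of `g`. -/
def cyclicCode {F : Type*} [Field F] (n : ℕ) (g : F[X]) : Submodule F (Fin n → F) where
  carrier := {c | g ∣ wordPoly c}
  zero_mem' := by simp [wordPoly]
  add_mem' := by
    intro a b ha hb
    have h : wordPoly (a + b) = wordPoly a + wordPoly b := by
      simp [wordPoly, add_mul, Finset.sum_add_distrib]
    simpa only [Set.mem_ofPred_eq, h] using dvd_add ha hb
  smul_mem' := by
    intro r a ha
    have h : wordPoly (r • a) = C r * wordPoly a := by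
      simp [wordPoly, Finset.mul_sum, mul_assoc]
    simpa only [Set.mem_ofPred_eq, h] using Dvd.dvd.mul_left ha (C r)

/-- The (finite) set of the minimal polynomials over `F` of the powers `α ^ i`, `i ∈ S`. -/
def minpolys (F : Type*) {K : Type*} [Field F] [Field K] [Algebra F K] (α : K) (S : Finset ℕ) :
    Finset F[X] :=
  open Classical in S.image fun i => minpoly F (α ^ i)

/-- The generator polynomial of the BCH code with designed distance `δ` and first zero `α ^ b`:
the least common multiple of the minimal polynomials of `α ^ b, …, α ^ (b + δ - 2)`. Minimal
polynomials are monic and irreducible, so this is the product of the distinct ones among them. -/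
def bchGenerator (F : Type*) {K : Type*} [Field F] [Field K] [Algebra F K] (α : K) (b δ : ℕ) :
    F[X] :=
  ∏ p ∈ minpolys F α (Finset.Ico b (b + δ - 1)), p

/-- The BCH code of length `n` over `F` with zeros `α ^ b, …, α ^ (b + δ - 2)`. -/
def bchCode (F : Type*) {K : Type*} [Field F] [Field K] [Algebra F K] (n : ℕ) (α : K) (b δ : ℕ) :
    Submodule F (Fin n → F) :=
  cyclicCode n (bchGenerator F α b δ)

/-- The cyclic code of length `n` generated by the product of all the distinct minimal polynomials
of powers of `α` (an `n`-th root of unity), other than those of `α ^ i` with `i ∈ T`. -/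
def coCode (F : Type*) {K : Type*} [Field F] [Field K] [Algebra F K] (n : ℕ) (α : K)
    (T : Finset ℕ) : Submodule F (Fin n → F) :=
  open Classical in
  cyclicCode n (∏ p ∈ minpolys F α (Finset.range n) \ minpolys F α T, p)

/-- The Euclidean dual of a code. -/
def euclideanDual {F : Type*} [Field F] {n : ℕ} (D : Submodule F (Fin n → F)) :
    Submodule F (Fin n → F) where
  carrier := {x | ∀ c ∈ D, c ⬝ᵥ x = 0}
  zero_mem' := by simp
  add_mem' := by
    intro a b ha hb c hc
    rw [dotProduct_add, ha c hc, hb c hc, add_zero]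
  smul_mem' := by
    intro r a ha c hc
    rw [dotProduct_smul, ha c hc, smul_zero]

/-- The code obtained by reading every word of `D` backwards. -/
def reverseCode {F : Type*} [Field F] {n : ℕ} (D : Submodule F (Fin n → F)) :
    Submodule F (Fin n → F) :=
  D.map (LinearMap.funLeft F F (Fin.rev : Fin n → Fin n))

/-! ### Quantum codes -/

/-- The state space of `n` qudits with alphabet `A`: the Hilbert space `(ℂ^A)^{⊗ n}`, with its
orthonormal basis indexed by the words of length `n` over `A`. -/
abbrev QuditSpace (A : Type*) [Fintype A] (n : ℕ) : Type _ := EuclideanSpace ℂ (Fin n → A)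

/-- The operator with matrix `E` acts only on the qudits in `S`, that is, `E = E' ⊗ id` with `E'`
an operator on the qudits in `S`: an entry `E x y` vanishes unless `x` and `y` agree outside `S`,
and then it depends only on the restrictions of `x` and `y` to `S`. -/
def ActsOn {A : Type*} {n : ℕ} (E : Matrix (Fin n → A) (Fin n → A) ℂ) (S : Finset (Fin n)) :
    Prop :=
  (∀ x y, (∃ i, i ∉ S ∧ x i ≠ y i) → E x y = 0) ∧
  (∀ x y x' y', (∀ i, i ∉ S → x i = y i) → (∀ i, i ∉ S → x' i = y' i) →
    (∀ i ∈ S, x i = x' i) → (∀ i ∈ S, y i = y' i) → E x y = E x' y')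

/-- The code `Q` detects the error `E`: with `P` the orthogonal projection onto `Q`, the operator
`P E P` is a scalar multiple of `P`. -/
def Detects {A : Type*} [Fintype A] [DecidableEq A] {n : ℕ} (Q : Submodule ℂ (QuditSpace A n))
    (E : Matrix (Fin n → A) (Fin n → A) ℂ) : Prop :=
  ∃ a : ℂ, ∀ u ∈ Q, ∀ v ∈ Q, inner ℂ u (Matrix.toEuclideanLin E v) = a * inner ℂ u v

/-- `Q` is an `[[n, k, d]]_q` quantum code, where `q` is the size of the alphabet `A`: a subspace
of dimension `q ^ k` whose minimum distance (the least number of qudits on which an undetected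
error acts) is exactly `d`. This is the usual notion for codes of dimension at least two. -/
def IsQuantumCode {A : Type*} [Fintype A] [DecidableEq A] {n : ℕ}
    (Q : Submodule ℂ (QuditSpace A n)) (k d : ℕ) : Prop :=
  Module.finrank ℂ Q = Fintype.card A ^ k ∧
  IsLeast {w : ℕ | ∃ S : Finset (Fin n), S.card = w ∧
    ∃ E : Matrix (Fin n → A) (Fin n → A) ℂ, ActsOn E S ∧ ¬ Detects Q E} d

/-- The (unnormalised) state `∑_{c ∈ D} |x + c⟩` of the coset `x + D`. -/
def cosetState {F : Type*} [Field F] [Fintype F] {n : ℕ} (D : Submodule F (Fin n → F))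
    (x : Fin n → F) : QuditSpace F n :=
  open Classical in WithLp.toLp 2 fun y => if y - x ∈ D then 1 else 0

/-- The quantum code given by the CSS construction applied to classical codes `C₂ ⊆ C₁`: the span
of the states of the cosets `x + C₂`, `x ∈ C₁`. -/
def cssCode {F : Type*} [Field F] [Fintype F] {n : ℕ} (C₁ C₂ : Submodule F (Fin n → F)) :
    Submodule ℂ (QuditSpace F n) :=
  Submodule.span ℂ (cosetState C₂ '' (C₁ : Set (Fin n → F)))

end QBCH

end

/-! Write the matrix elements of an error `E` acting on a set `S` of fewer than `q` qudits between
coset states as sums of entries of `E` at words of `C₁`. An entry vanishes unless its two words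
agree outside `S`; since nonzero words of `C₁` have weight at least `q`, only diagonal entries
survive. These depend only on the values on `S`. As the dual of `C₂` has no nonzero word of weight
at most `#S`, `C₂` takes all values on `S`, so every coset of `C₂` gives the same diagonal sum
(`cssCode_detects`).

Both weight bounds are BCH bounds (`le_hammingNorm_of_aeval_eq_zero`) for `q - 1` consecutive zeros:
`C₁` has them by definition, and the dual of `C₂` is the reversal of the BCH code `C`
(`euclideanDual_cyclicCode`).

For the dimension, multiplication by `q` modulo `q ^ 2 - 1` swaps two base `q` digits, so a coset
has one element when the digits agree and two otherwise (`qCoset_digits`). Both BCH generators thus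
have degree `1 + 2 (q - 2) = 2q - 3`, whence `dim C₁ - dim C₂ = (q² - 1) - 2 (2q - 3) = q² - 4q +
5`. Disjointness of the cosets gives `C₂ ⊆ C₁`. -/

open Polynomial

noncomputable section

namespace QBCH

/-! ### The CSS construction -/

section

variable {F : Type*} [Field F] {n : ℕ}

theorem hammingNorm_le_card_of_support [DecidableEq F] {x : Fin n → F} {S : Finset (Fin n)}
    (h : ∀ i, i ∉ S → x i = 0) : hammingNorm x ≤ S.card :=
  Finset.card_le_card fun i hi => by
    by_contra hS
    exact (Finset.mem_filter.1 hi).2 (h i hS)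

/-- If every nonzero word of the dual of `D` has weight more than `#S`, then the words of `D`
take all possible values on `S`. -/
theorem exists_mem_eq_on_of_dual_weight [DecidableEq F] (D : Submodule F (Fin n → F))
    (S : Finset (Fin n)) (h : ∀ x ∈ euclideanDual D, x ≠ 0 → S.card < hammingNorm x)
    (z : Fin n → F) : ∃ c ∈ D, ∀ i ∈ S, c i = z i := by
  let r : (Fin n → F) →ₗ[F] (S → F) := LinearMap.funLeft F F (fun i : S => (i : Fin n))
  have htop : D.map r = ⊤ := by
    -- A proper image is killed by a nonzero functional; composed with restriction to `S`, it is a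
    -- nonzero dual word supported on `S`.
    by_contra hne
    obtain ⟨f, hf0, hf⟩ := Submodule.exists_le_ker_of_lt_top _ (lt_top_iff_ne_top.2 hne)
    let x : Fin n → F := fun i => f (r (Pi.single i 1))
    have hx : ∀ c, c ⬝ᵥ x = f (r c) := by
      intro c
      have := (f ∘ₗ r).pi_apply_eq_sum_univ c
      simp only [LinearMap.comp_apply, smul_eq_mul] at this
      rw [this]
      refine Finset.sum_congr rfl fun i _ => ?_
      simp only [x]
      congr 3
      ext j
      simp [Pi.single_apply, eq_comm]
    have hx0 : x ≠ 0 := by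
      intro h0
      refine hf0 (LinearMap.ext fun y => ?_)
      obtain ⟨c, rfl⟩ := LinearMap.funLeft_surjective_of_injective F F
        (fun i : S => (i : Fin n)) Subtype.val_injective y
      have := hx c
      rw [h0, dotProduct_zero] at this
      exact this.symm
    refine (h x (fun c hc => ?_) hx0).not_ge (hammingNorm_le_card_of_support fun i hi => ?_)
    · rw [hx]
      exact hf ⟨c, hc, rfl⟩
    · have : r (Pi.single i 1) = 0 := funext fun j =>
        Pi.single_eq_of_ne (fun hj : (j : Fin n) = i => hi (hj ▸ j.2)) _
      simp only [x, this, map_zero]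
  have : r z ∈ D.map r := by rw [htop]; trivial
  obtain ⟨c, hc, hcz⟩ := this
  exact ⟨c, hc, fun i hi => congrFun hcz ⟨i, hi⟩⟩

variable [Fintype F]

theorem cosetState_apply (D : Submodule F (Fin n → F)) (x y : Fin n → F) [Decidable (y - x ∈ D)] :
    cosetState D x y = if y - x ∈ D then 1 else 0 := by
  simp only [cosetState]
  congr

theorem cosetState_eq_of_sub_mem (D : Submodule F (Fin n → F)) {x y : Fin n → F}
    (h : x - y ∈ D) : cosetState D x = cosetState D y := by
  classical
  ext z
  rw [cosetState_apply, cosetState_apply]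
  have : z - x ∈ D ↔ z - y ∈ D := by
    rw [show z - y = (z - x) + (x - y) by abel]
    exact (D.add_mem_iff_left h).symm
  simp [this]

theorem inner_cosetState_toEuclideanLin [DecidableEq F] (D : Submodule F (Fin n → F))
    [Fintype D] (x y : Fin n → F)
    (E : Matrix (Fin n → F) (Fin n → F) ℂ) :
    inner ℂ (cosetState D x) (Matrix.toEuclideanLin E (cosetState D y)) =
      ∑ c : D, ∑ c' : D, E (x + c) (y + c') := by
  classical
  have hsum : ∀ (w : Fin n → F) (f : (Fin n → F) → ℂ),
      ∑ z, (if z - w ∈ D then f z else 0) = ∑ c : D, f (w + c) := by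
    intro w f
    rw [← Equiv.sum_comp (Equiv.addLeft w)]
    simp only [Equiv.coe_addLeft, add_sub_cancel_left]
    rw [← Finset.sum_filter]
    exact Finset.sum_subtype _ (by simp) (fun c => f (w + c))
  rw [← hsum x (fun z => ∑ c' : D, E z (y + c'))]
  simp only [PiLp.inner_apply, Matrix.toLpLin_apply, Matrix.mulVec, dotProduct, cosetState_apply]
  refine Finset.sum_congr rfl fun z _ => ?_
  rw [← hsum y]
  split_ifs <;> simp

theorem inner_cosetState_self [DecidableEq F] (D : Submodule F (Fin n → F)) (x : Fin n → F) :
    inner ℂ (cosetState D x) (cosetState D x) = (Nat.card D : ℂ) := by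
  classical
  have h := inner_cosetState_toEuclideanLin D x x 1
  have h1 : Matrix.toEuclideanLin (1 : Matrix (Fin n → F) (Fin n → F) ℂ) (cosetState D x) =
    cosetState D x := by simp
  rw [h1] at h
  rw [h]
  simp [Matrix.one_apply]

theorem inner_cosetState_of_sub_notMem [DecidableEq F] (D : Submodule F (Fin n → F))
    {x y : Fin n → F} (hxy : x - y ∉ D) :
    inner ℂ (cosetState D x) (cosetState D y) = (0 : ℂ) := by
  classical
  rw [PiLp.inner_apply]
  refine Finset.sum_eq_zero fun z _ => ?_
  rw [cosetState_apply, cosetState_apply]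
  by_cases h1 : z - x ∈ D
  · have h2 : z - y ∉ D := fun h2 => hxy (by simpa using D.sub_mem h2 h1)
    simp [h2]
  · simp [h1]

/-- The condition is sesquilinear in `u` and `v`, provided the scalar is the same for all pairs of
generators. -/
theorem detects_span {A : Type*} [Fintype A] [DecidableEq A] (T : Set (QuditSpace A n))
    (E : Matrix (Fin n → A) (Fin n → A) ℂ) (a : ℂ)
    (h : ∀ u ∈ T, ∀ v ∈ T, inner ℂ u (Matrix.toEuclideanLin E v) = a * inner ℂ u v) :
    Detects (Submodule.span ℂ T) E := by
  refine ⟨a, fun u hu v hv => ?_⟩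
  induction hu, hv using Submodule.span_induction₂ with
  | mem_mem x y hx hy => exact h x hx y hy
  | zero_left y hy => simp
  | zero_right x hx => simp
  | add_left x y z _ _ _ h1 h2 => simp only [inner_add_left, h1, h2, mul_add]
  | add_right x y z _ _ _ h1 h2 => simp only [map_add, inner_add_right, h1, h2, mul_add]
  | smul_left r x y _ _ h => rw [inner_smul_left, inner_smul_left, h]; ring
  | smul_right r x y _ _ h => rw [map_smul, inner_smul_right, inner_smul_right, h]; ring

/-- A CSS code detects every error on fewer qudits than the weights of the nonzero words of `C₁`
and of the dual of `C₂`. -/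
theorem cssCode_detects [DecidableEq F] {C₁ C₂ : Submodule F (Fin n → F)} (hle : C₂ ≤ C₁)
    {S : Finset (Fin n)} (h₁ : ∀ x ∈ C₁, x ≠ 0 → S.card < hammingNorm x)
    (h₂ : ∀ x ∈ euclideanDual C₂, x ≠ 0 → S.card < hammingNorm x)
    {E : Matrix (Fin n → F) (Fin n → F) ℂ} (hE : ActsOn E S) : Detects (cssCode C₁ C₂) E := by
  classical
  have hcard : (Nat.card C₂ : ℂ) ≠ 0 := Nat.cast_ne_zero.2 Nat.card_pos.ne'
  -- only equal words of `C₁` contribute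
  have hoff : ∀ x ∈ C₁, ∀ y ∈ C₁, x ≠ y → E x y = 0 := by
    intro x hx y hy hxy
    refine hE.1 x y ?_
    by_contra! hcon
    have hw := h₁ (x - y) (C₁.sub_mem hx hy) (sub_ne_zero.2 hxy)
    exact hw.not_ge (hammingNorm_le_card_of_support fun i hi => by simp [hcon i hi])
  -- The scalar is forced by the coset `C₂` itself, where `x = y = 0`.
  refine detects_span _ E ((∑ c : C₂, E c c) / Nat.card C₂) ?_
  rintro _ ⟨x, hx, rfl⟩ _ ⟨y, hy, rfl⟩
  by_cases hxy : x - y ∈ C₂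
  · rw [← cosetState_eq_of_sub_mem C₂ hxy, inner_cosetState_self, div_mul_cancel₀ _ hcard,
      inner_cosetState_toEuclideanLin]
    have hdiag : ∀ c : C₂, ∑ c' : C₂, E (x + c) (x + c') = E (x + c) (x + c) := by
      intro c
      refine Finset.sum_eq_single c (fun b _ hb => ?_) (by simp)
      exact hoff _ (C₁.add_mem hx (hle c.2)) _ (C₁.add_mem hx (hle b.2))
        fun h => hb (Subtype.ext (add_left_cancel h).symm)
    simp only [hdiag]
    -- Since `c₀` agrees with `x` on `S`, the diagonal entries at `x + c` and `c₀ + c` coincide, and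
    -- translation by `c₀` permutes `C₂`.
    obtain ⟨c₀, hc₀, hS⟩ := exists_mem_eq_on_of_dual_weight C₂ S h₂ x
    rw [← Equiv.sum_comp (Equiv.addLeft (⟨c₀, hc₀⟩ : C₂)) (fun c : C₂ => E c c)]
    refine Finset.sum_congr rfl fun c _ => ?_
    refine hE.2 _ _ _ _ (fun _ _ => rfl) (fun _ _ => rfl) (fun i hi => ?_) (fun i hi => ?_) <;>
      simp [hS i hi]
  · rw [inner_cosetState_of_sub_notMem C₂ hxy, mul_zero, inner_cosetState_toEuclideanLin]
    refine Finset.sum_eq_zero fun c _ => Finset.sum_eq_zero fun c' _ => ?_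
    refine hoff _ (C₁.add_mem hx (hle c.2)) _ (C₁.add_mem hy (hle c'.2)) fun h => hxy ?_
    have : x - y = (c' : Fin n → F) - c := by
      rw [sub_eq_sub_iff_add_eq_add, h, add_comm]
    rw [this]
    exact C₂.sub_mem c'.2 c.2

/-- States of distinct cosets have disjoint supports, hence are orthogonal; one for each element of
`C₁ ⧸ C₂` gives a basis. -/
theorem finrank_cssCode {C₁ C₂ : Submodule F (Fin n → F)} (hle : C₂ ≤ C₁) {k : ℕ}
    (hk : Module.finrank F C₁ = Module.finrank F C₂ + k) :
    Module.finrank ℂ (cssCode C₁ C₂) = Fintype.card F ^ k := by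
  classical
  let N := C₂.submoduleOf C₁
  let b : C₁ ⧸ N → QuditSpace F n := fun t => cosetState C₂ (t.out : C₁)
  have hspan : cssCode C₁ C₂ = Submodule.span ℂ (Set.range b) := by
    unfold cssCode
    congr 1
    ext v
    constructor
    · rintro ⟨x, hx, rfl⟩
      refine ⟨Submodule.Quotient.mk ⟨x, hx⟩, ?_⟩
      have h : N.mkQ (N.mkQ ⟨x, hx⟩).out = N.mkQ ⟨x, hx⟩ := Quotient.out_eq _
      exact cosetState_eq_of_sub_mem C₂ ((Submodule.Quotient.eq N).1 h)
    · rintro ⟨t, rfl⟩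
      exact ⟨_, t.out.2, rfl⟩
  have hli : LinearIndependent ℂ b := by
    refine linearIndependent_of_ne_zero_of_inner_eq_zero (𝕜 := ℂ) (fun t h0 => ?_) fun s t hst => ?_
    · have := inner_cosetState_self C₂ (t.out : C₁)
      simp only [b] at h0
      rw [h0, inner_zero_left] at this
      exact Nat.card_pos.ne' (Nat.cast_eq_zero.1 this.symm)
    · refine inner_cosetState_of_sub_notMem C₂ fun h => hst ?_
      have : N.mkQ s.out = N.mkQ t.out := (Submodule.Quotient.eq N).2 h
      simpa using! this
  have hquot : Module.finrank F (C₁ ⧸ N) = k := by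
    have h1 := Submodule.finrank_quotient_add_finrank N
    have h2 : Module.finrank F N = Module.finrank F C₂ :=
      (Submodule.submoduleOfEquivOfLe hle).finrank_eq
    omega
  have : Fintype (C₁ ⧸ N) := Fintype.ofFinite _
  rw [hspan, finrank_span_eq_card hli, Module.card_eq_pow_finrank (K := F), hquot]

/-- The CSS construction. -/
theorem exists_isQuantumCode_cssCode [DecidableEq F] {C₁ C₂ : Submodule F (Fin n → F)}
    (hle : C₂ ≤ C₁) {k δ : ℕ} (hk0 : k ≠ 0) 
    (hk : Module.finrank F C₁ = Module.finrank F C₂ + k)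
    (h₁ : ∀ x ∈ C₁, x ≠ 0 → δ ≤ hammingNorm x)
    (h₂ : ∀ x ∈ euclideanDual C₂, x ≠ 0 → δ ≤ hammingNorm x) :
    ∃ d, δ ≤ d ∧ IsQuantumCode (cssCode C₁ C₂) k d := by
  classical
  let W := {w : ℕ | ∃ S : Finset (Fin n), S.card = w ∧
    ∃ E : Matrix (Fin n → F) (Fin n → F) ℂ, ActsOn E S ∧ ¬ Detects (cssCode C₁ C₂) E}
  have hne : W.Nonempty := by
    obtain ⟨x, hx, hx2⟩ : ∃ x ∈ C₁, x ∉ C₂ := by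
      by_contra! h
      have := le_antisymm h hle
      subst this
      omega
    -- The matrix unit taking `|0⟩` to `|x⟩` has a nonzero matrix element between two orthogonal
    -- code states, so it is undetected. Hence the least weight exists.
    refine ⟨_, Finset.univ, rfl, Matrix.single x 0 1, ⟨by simp, ?_⟩, ?_⟩
    · intro a b a' b' _ _ h h'
      rw [show a = a' from funext fun i => h i (Finset.mem_univ i),
        show b = b' from funext fun i => h' i (Finset.mem_univ i)]
    · rintro ⟨a, ha⟩
      have h := ha (cosetState C₂ x) (Submodule.subset_span ⟨x, hx, rfl⟩) (cosetState C₂ 0)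
        (Submodule.subset_span ⟨0, C₁.zero_mem, rfl⟩)
      rw [inner_cosetState_of_sub_notMem C₂ (by simpa using hx2), mul_zero,
        inner_cosetState_toEuclideanLin, Finset.sum_eq_single 0, Finset.sum_eq_single 0] at h
      · simp at h
      · intro c _ hc
        simp [Ne.symm (show (c : Fin n → F) ≠ 0 by simpa using hc)]
      · simp
      · intro c _ hc
        simp [hc]
      · simp
  refine ⟨sInf W, ?_, finrank_cssCode hle hk, Nat.sInf_mem hne, fun w hw => Nat.sInf_le hw⟩
  obtain ⟨S, hS, E, hE, hdet⟩ := Nat.sInf_mem hne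
  by_contra! hlt
  refine hdet (cssCode_detects hle (fun x hx h0 => ?_) (fun x hx h0 => ?_) hE)
  · have := h₁ x hx h0
    omega
  · have := h₂ x hx h0
    omega

end

/-! ### Cyclic codes, their duals and the BCH bound -/

section

variable {F : Type*} [Field F] {n : ℕ}

theorem coeff_wordPoly (c : Fin n → F) (i : Fin n) : (wordPoly c).coeff i = c i := by
  simp [wordPoly, finsetSum_coeff, coeff_C_mul, coeff_X_pow, Fin.val_inj]

theorem degree_wordPoly_lt (c : Fin n → F) : (wordPoly c).degree < n :=
  (degree_sum_le _ _).trans_lt <| (Finset.sup_lt_iff (WithBot.bot_lt_coe n)).2 fun i _ =>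
    (degree_C_mul_X_pow_le _ _).trans_lt (Nat.cast_lt.2 i.2)

theorem wordPoly_coeff {p : F[X]} (hp : p.degree < n) :
    wordPoly (fun i : Fin n => p.coeff i) = p := by
  ext i
  by_cases hi : i < n
  · exact coeff_wordPoly (fun i : Fin n => p.coeff i) ⟨i, hi⟩
  · rw [coeff_eq_zero_of_degree_lt (hp.trans_le (by simpa using hi)),
      coeff_eq_zero_of_degree_lt ((degree_wordPoly_lt _).trans_le (by simpa using hi))]

theorem aeval_wordPoly {K : Type*} [Field K] [Algebra F K] (c : Fin n → F) (x : K) :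
    aeval x (wordPoly c) = ∑ i, algebraMap F K (c i) * x ^ (i : ℕ) := by
  simp [wordPoly]

/-- Multiplication by `g` identifies the polynomials of degree below `n - deg g` with the code. -/
theorem finrank_cyclicCode {g : F[X]} (hg : g.Monic) (hn : g.natDegree ≤ n) :
    Module.finrank F (cyclicCode n g) = n - g.natDegree := by
  let coeffs : F[X] →ₗ[F] Fin n → F := LinearMap.pi fun i => lcoeff F i
  let φ : degreeLT F (n - g.natDegree) →ₗ[F] Fin n → F :=
    coeffs ∘ₗ LinearMap.mulLeft F g ∘ₗ (degreeLT F (n - g.natDegree)).subtype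
  have hdeg : ∀ p : F[X], (g * p).degree < n ↔ p.degree < (n - g.natDegree : ℕ) := by
    intro p
    rcases eq_or_ne p 0 with rfl | hp
    · simp
    · rw [degree_eq_natDegree (mul_ne_zero hg.ne_zero hp), degree_eq_natDegree hp,
        natDegree_mul hg.ne_zero hp, Nat.cast_lt, Nat.cast_lt]
      omega
  have hφ : ∀ p, wordPoly (φ p) = g * p := fun p =>
    wordPoly_coeff ((hdeg _).2 (mem_degreeLT.1 p.2))
  have hinj : Function.Injective φ := by
    rw [← LinearMap.ker_eq_bot, LinearMap.ker_eq_bot']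
    intro p hp
    have := hφ p
    rw [hp] at this
    simpa [wordPoly, hg.ne_zero] using this
  have hrange : LinearMap.range φ = cyclicCode n g := by
    ext c
    constructor
    · rintro ⟨p, rfl⟩
      exact ⟨p, hφ p⟩
    · rintro ⟨p, hp⟩
      refine ⟨⟨p, mem_degreeLT.2 ((hdeg p).1 (hp ▸ degree_wordPoly_lt c))⟩, funext fun i => ?_⟩
      exact (congrArg (coeff · (i : ℕ)) hp).symm.trans (coeff_wordPoly c i)
  rw [← hrange, LinearMap.finrank_range_of_inj hinj, (degreeLTEquiv F _).finrank_eq,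
    Module.finrank_fin_fun]

theorem finrank_euclideanDual (D : Submodule F (Fin n → F)) :
    Module.finrank F (euclideanDual D) = n - Module.finrank F D := by
  have h : euclideanDual D =
      LinearMap.BilinForm.orthogonal (Matrix.toBilin' (1 : Matrix (Fin n) (Fin n) F)) D := by
    ext x
    simp [euclideanDual, LinearMap.BilinForm.mem_orthogonal_iff, Matrix.toBilin'_apply']
  rw [h, LinearMap.BilinForm.finrank_orthogonal, Module.finrank_fin_fun]
  exact (Matrix.nondegenerate_of_det_ne_zero (by simp)).toBilin'

theorem funLeft_rev_injective :
    Function.Injective (LinearMap.funLeft F F (Fin.rev : Fin n → Fin n)) :=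
  LinearMap.funLeft_injective_of_surjective _ _ _ Fin.rev_surjective

theorem finrank_reverseCode (D : Submodule F (Fin n → F)) :
    Module.finrank F (reverseCode D) = Module.finrank F D :=
  (D.equivMapOfInjective _ funLeft_rev_injective).finrank_eq.symm

/-- This is the source of the reversal in the dual of a cyclic code. -/
theorem coeff_mul_wordPoly [NeZero n] (c y : Fin n → F) :
    (wordPoly c * wordPoly y).coeff (n - 1) = ∑ i, c i * y i.rev := by
  have hn : n - 1 + 1 = n := Nat.succ_pred (NeZero.ne n)
  rw [coeff_mul, Finset.Nat.sum_antidiagonal_eq_sum_range_succ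
    (fun i j => (wordPoly c).coeff i * (wordPoly y).coeff j), Nat.succ_eq_add_one, hn,
    Finset.sum_range]
  refine Finset.sum_congr rfl fun i _ => ?_
  rw [coeff_wordPoly, ← coeff_wordPoly y, Fin.val_rev, Nat.sub_sub, Nat.add_comm 1]

/-- If `g h = X ^ n - 1`, then the dual of the cyclic code generated by `g` is the reverse of the
cyclic code generated by `h`. -/
theorem euclideanDual_cyclicCode [NeZero n] {g h : F[X]} (hg : g.Monic) (hh : h.Monic)
    (hgh : g * h = X ^ n - 1) :
    euclideanDual (cyclicCode n g) = reverseCode (cyclicCode n h) := by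
  have hdeg : g.natDegree + h.natDegree = n := by
    rw [← hg.natDegree_mul hh, hgh, ← C_1, natDegree_X_pow_sub_C]
  symm
  refine Submodule.eq_of_le_of_finrank_eq ?_ ?_
  · rintro _ ⟨y, ⟨b, hb⟩, rfl⟩ c ⟨a, ha⟩
    have hn : 0 < n := Nat.pos_of_neZero n
    -- The left side has degree at most `2n - 2`, so `a * b` has degree at most `n - 2`, and neither
    -- `X ^ n * (a * b)` nor `a * b` has a term of degree `n - 1`. The dimension count then gives
    -- equality of the codes.
    have h1 : wordPoly c * wordPoly y = (X ^ n - 1) * (a * b) := by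
      rw [ha, hb, ← hgh]
      ring
    refine (coeff_mul_wordPoly c y).symm.trans ?_
    rcases eq_or_ne (a * b) 0 with h0 | h0
    · rw [h1, h0, mul_zero, coeff_zero]
    have hc : wordPoly c ≠ 0 := by
      rw [ha]
      exact mul_ne_zero hg.ne_zero (left_ne_zero_of_mul h0)
    have hy : wordPoly y ≠ 0 := by
      rw [hb]
      exact mul_ne_zero hh.ne_zero (right_ne_zero_of_mul h0)
    have h2 := congrArg natDegree h1
    have h3 := (natDegree_lt_iff_degree_lt hc).2 (degree_wordPoly_lt c)
    have h4 := (natDegree_lt_iff_degree_lt hy).2 (degree_wordPoly_lt y)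
    rw [natDegree_mul hc hy, ← hgh, (hg.mul hh).natDegree_mul' h0, hg.natDegree_mul hh,
      hdeg] at h2
    rw [h1, sub_mul, one_mul, coeff_sub, coeff_X_pow_mul', if_neg (by omega),
      coeff_eq_zero_of_natDegree_lt (by omega), sub_zero]
  · rw [finrank_reverseCode, finrank_euclideanDual, finrank_cyclicCode hg (by omega),
      finrank_cyclicCode hh (by omega)]
    omega

theorem hammingNorm_comp_rev [DecidableEq F] (y : Fin n → F) :
    hammingNorm (y ∘ Fin.rev) = hammingNorm y :=
  Finset.card_equiv Fin.revPerm (by simp)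

/-- The BCH bound: a nonzero word whose polynomial vanishes at `α ^ b, …, α ^ (b + δ - 2)` has
weight at least `δ`. -/
theorem le_hammingNorm_of_aeval_eq_zero [DecidableEq F] {K : Type*} [Field K] [Algebra F K]
    {α : K} (hα : α ≠ 0) (hn : n ≤ orderOf α) {b δ : ℕ} {c : Fin n → F} (hc : c ≠ 0)
    (h : ∀ i, i + 1 < δ → aeval (α ^ (b + i)) (wordPoly c) = 0) : δ ≤ hammingNorm c := by
  by_contra! hlt
  let S := Finset.univ.filter fun i => c i ≠ 0
  have hS : S.card < δ := hlt
  -- Linear combinations of the vanishing conditions, with the coefficients of `p` as weights.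
  have hp : ∀ p : K[X], p.natDegree + 1 < δ →
      ∑ j, algebraMap F K (c j) * (α ^ (j : ℕ)) ^ b * p.eval (α ^ (j : ℕ)) = 0 := by
    intro p hp
    simp only [eval_eq_sum_range, Finset.mul_sum]
    rw [Finset.sum_comm]
    refine Finset.sum_eq_zero fun i hi => ?_
    have := h i (by simp at hi; omega)
    rw [aeval_wordPoly] at this
    rw [← mul_zero (p.coeff i), ← this, Finset.mul_sum]
    refine Finset.sum_congr rfl fun j _ => ?_
    rw [← pow_mul α (b + i), mul_comm (b + i), pow_mul, pow_add]
    ring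
  obtain ⟨j₀, hj₀⟩ := Function.ne_iff.1 hc
  have hj₀S : j₀ ∈ S := by simpa [S] using hj₀
  -- This `p` has degree `#S - 1 ≤ δ - 2` and vanishes at every support point except `j₀`, so the
  -- sum reduces to one nonzero term.
  let p : K[X] := ∏ j ∈ S.erase j₀, (X - C (α ^ (j : ℕ)))
  have hpdeg : p.natDegree + 1 = S.card := by
    rw [natDegree_prod_of_monic _ _ fun j _ => monic_X_sub_C _]
    simp only [natDegree_X_sub_C, Finset.sum_const, smul_eq_mul, mul_one]
    exact Finset.card_erase_add_one hj₀S
  have hsum := hp p (by omega)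
  rw [Finset.sum_eq_single j₀] at hsum
  · rw [mul_eq_zero, mul_eq_zero, eval_prod, Finset.prod_eq_zero_iff] at hsum
    rcases hsum with (hsum | hsum) | ⟨j, hj, hsum⟩
    · exact hj₀ (by simpa using hsum)
    · exact pow_ne_zero _ (pow_ne_zero _ hα) hsum
    · rw [eval_sub, eval_X, eval_C, sub_eq_zero] at hsum
      have := pow_injOn_Iio_orderOf (Set.mem_Iio.2 (j₀.2.trans_le hn))
        (Set.mem_Iio.2 (j.2.trans_le hn)) hsum
      exact Finset.ne_of_mem_erase hj (Fin.ext this.symm)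
  · intro j _ hj
    by_cases hcj : c j = 0
    · simp [hcj]
    · rw [eval_prod, Finset.prod_eq_zero (i := j), mul_zero]
      · simp [S, hj, hcj]
      · simp
  · simp

end

/-! ### Minimal polynomials and cosets -/

section

variable {F K : Type*} [Field F] [Field K] [Algebra F K] {α : K}

theorem mem_minpolys {S : Finset ℕ} {p : F[X]} :
    p ∈ minpolys F α S ↔ ∃ i ∈ S, minpoly F (α ^ i) = p := by
  simp [minpolys]

theorem aeval_prod_minpolys {S : Finset ℕ} {x : K} :
    aeval x (∏ p ∈ minpolys F α S, p) = 0 ↔ ∃ i ∈ S, aeval x (minpoly F (α ^ i)) = 0 := by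
  rw [map_prod, Finset.prod_eq_zero_iff]
  constructor
  · rintro ⟨p, hp, hx⟩
    obtain ⟨i, hi, rfl⟩ := mem_minpolys.1 hp
    exact ⟨i, hi, hx⟩
  · rintro ⟨i, hi, hx⟩
    exact ⟨_, mem_minpolys.2 ⟨i, hi, rfl⟩, hx⟩

theorem minpolys_subset_range (hα : 0 < orderOf α) (S : Finset ℕ) :
    minpolys F α S ⊆ minpolys F α (Finset.range (orderOf α)) := by
  intro p hp
  obtain ⟨i, -, rfl⟩ := mem_minpolys.1 hp
  exact mem_minpolys.2 ⟨i % orderOf α, Finset.mem_range.2 (Nat.mod_lt _ hα),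
    by rw [pow_mod_orderOf]⟩

theorem le_hammingNorm_of_mem_bchCode [DecidableEq F] {n : ℕ} (hα : α ≠ 0) (hn : n ≤ orderOf α)
    {b δ : ℕ} {c : Fin n → F} (hcC : c ∈ bchCode F n α b δ) (hc : c ≠ 0) :
    δ ≤ hammingNorm c := by
  refine le_hammingNorm_of_aeval_eq_zero hα hn (b := b) hc fun i hi => ?_
  obtain ⟨a, ha⟩ := hcC
  rw [ha, map_mul, bchGenerator, aeval_prod_minpolys.2 ⟨b + i, ?_, minpoly.aeval _ _⟩, zero_mul]
  simp
  omega

variable [Finite K]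

theorem monic_prod_of_subset_minpolys {S : Finset ℕ} {P : Finset F[X]} (hP : P ⊆ minpolys F α S) :
    (∏ p ∈ P, p).Monic :=
  monic_prod_of_monic _ _ fun p hp => by
    obtain ⟨i, -, rfl⟩ := mem_minpolys.1 (hP hp)
    exact minpoly.monic (Algebra.IsIntegral.isIntegral _)

/-- Distinct minimal polynomials are monic irreducibles, hence pairwise coprime. -/
theorem prod_minpolys_dvd_iff {S : Finset ℕ} {f : F[X]} :
    ∏ p ∈ minpolys F α S, p ∣ f ↔ ∀ i ∈ S, aeval (α ^ i) f = 0 := by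
  constructor
  · rintro ⟨g, rfl⟩ i hi
    rw [map_mul, aeval_prod_minpolys.2 ⟨i, hi, minpoly.aeval _ _⟩, zero_mul]
  · intro h
    refine Finset.prod_dvd_of_isRelPrime (fun p hp r hr hpr => ?_) fun p hp => ?_
    · obtain ⟨i, -, rfl⟩ := mem_minpolys.1 hp
      obtain ⟨j, -, rfl⟩ := mem_minpolys.1 hr
      have hi : IsIntegral F (α ^ i) := Algebra.IsIntegral.isIntegral _
      have hj : IsIntegral F (α ^ j) := Algebra.IsIntegral.isIntegral _
      refine (minpoly.irreducible hi).isRelPrime_iff_not_dvd.2 fun hdvd => hpr ?_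
      exact eq_of_monic_of_associated (minpoly.monic hi) (minpoly.monic hj)
        ((minpoly.irreducible hi).associated_of_dvd (minpoly.irreducible hj) hdvd)
    · obtain ⟨i, hi, rfl⟩ := mem_minpolys.1 hp
      exact minpoly.dvd _ _ (h i hi)

/-- The product divides `X ^ N - 1`, where `N` is the order of `α`, and has the `N` distinct powers
of `α` as roots; both are monic. -/
theorem prod_minpolys_range (hα : 0 < orderOf α) :
    ∏ p ∈ minpolys F α (Finset.range (orderOf α)), p = X ^ orderOf α - 1 := by
  classical
  set g := ∏ p ∈ minpolys F α (Finset.range (orderOf α)), p with hg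
  have hmonic : g.Monic := monic_prod_of_subset_minpolys subset_rfl
  have hdvd : g ∣ X ^ orderOf α - 1 := prod_minpolys_dvd_iff.2 fun i _ => by
    rw [map_sub, map_pow, aeval_X, map_one, ← pow_mul, mul_comm, pow_mul, pow_orderOf_eq_one,
      one_pow, sub_self]
  have hle : orderOf α ≤ g.natDegree := by
    by_contra! hlt
    refine hmonic.ne_zero ((Polynomial.map_eq_zero (algebraMap F K)).1 ?_)
    refine eq_zero_of_natDegree_lt_card_of_eval_eq_zero' (g.map (algebraMap F K))
      ((Finset.range (orderOf α)).image (α ^ ·)) ?_ ?_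
    · simp only [Finset.mem_image]
      rintro _ ⟨i, hi, rfl⟩
      rw [eval_map_algebraMap]
      exact aeval_prod_minpolys.2 ⟨i, hi, minpoly.aeval _ _⟩
    · rw [natDegree_map, Finset.card_image_of_injOn, Finset.card_range]
      · exact hlt
      · simpa using! pow_injOn_Iio_orderOf (x := α)
  have hn := monic_X_pow_sub_C (1 : F) hα.ne'
  rw [C_1] at hn
  refine (eq_of_monic_of_dvd_of_natDegree_le hmonic hn hdvd ?_).symm
  rwa [← C_1, natDegree_X_pow_sub_C]

theorem euclideanDual_coCode (hα : 0 < orderOf α) (b δ : ℕ) :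
    euclideanDual (coCode F (orderOf α) α (Finset.Ico b (b + δ - 1))) =
      reverseCode (bchCode F (orderOf α) α b δ) := by
  classical
  have : NeZero (orderOf α) := ⟨hα.ne'⟩
  refine euclideanDual_cyclicCode (monic_prod_of_subset_minpolys Finset.sdiff_subset)
    (monic_prod_of_subset_minpolys subset_rfl) ?_
  rw [bchGenerator, ← prod_minpolys_range hα]
  convert Finset.prod_sdiff (minpolys_subset_range (F := F) hα (Finset.Ico b (b + δ - 1)))

variable [Fintype F]

/-- The Galois group of a finite field is generated by Frobenius. -/
theorem isConjRoot_iff_exists_pow {x y : K} :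
    IsConjRoot F x y ↔ ∃ j : ℕ, y = x ^ Fintype.card F ^ j := by
  obtain ⟨p, hp⟩ := CharP.exists F
  have : Fact p.Prime := ⟨CharP.char_is_prime F p⟩
  rw [show IsConjRoot F x y ↔ IsConjRoot F y x from ⟨.symm, .symm⟩, isConjRoot_iff_exists_algEquiv]
  constructor
  · rintro ⟨σ, rfl⟩
    obtain ⟨j, hj⟩ := FiniteField.exists_forall_apply_eq_pow F p K σ
    exact ⟨j, by rw [hj, Nat.card_eq_fintype_card]⟩
  · rintro ⟨j, rfl⟩
    refine ⟨FiniteField.frobeniusAlgEquivOfAlgebraic F K ^ j, ?_⟩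
    rw [AlgEquiv.coe_pow, FiniteField.coe_frobeniusAlgEquivOfAlgebraic_iterate]

theorem isConjRoot_pow_iff {i t : ℕ} (ht : t < orderOf α) :
    IsConjRoot F (α ^ i) (α ^ t) ↔ t ∈ qCoset (Fintype.card F) (orderOf α) i := by
  rw [isConjRoot_iff_exists_pow]
  refine exists_congr fun j => ?_
  rw [← pow_mul, ← pow_mod_orderOf α (i * _)]
  exact ⟨fun h => pow_injOn_Iio_orderOf ht (Nat.mod_lt _ (by omega)) h, fun h => by rw [h]⟩

theorem aeval_minpoly_pow {i t : ℕ} (ht : t < orderOf α) :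
    aeval (α ^ t) (minpoly F (α ^ i)) = 0 ↔ t ∈ qCoset (Fintype.card F) (orderOf α) i := by
  rw [← isConjRoot_pow_iff ht, isConjRoot_iff_aeval_eq_zero (Algebra.IsIntegral.isIntegral _)]

theorem aeval_bchGenerator {b δ t : ℕ} (ht : t < orderOf α) :
    aeval (α ^ t) (bchGenerator F α b δ) = 0 ↔
      ∃ i ∈ Finset.Ico b (b + δ - 1), t ∈ qCoset (Fintype.card F) (orderOf α) i := by
  simp only [bchGenerator, aeval_prod_minpolys, aeval_minpoly_pow ht]

theorem minpoly_pow_ne_of_disjoint (hα : 0 < orderOf α) {i j : ℕ}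
    (h : Disjoint (qCoset (Fintype.card F) (orderOf α) i)
      (qCoset (Fintype.card F) (orderOf α) j)) :
    minpoly F (α ^ i) ≠ minpoly F (α ^ j) := by
  intro heq
  have hlt : i % orderOf α < orderOf α := Nat.mod_lt _ hα
  refine Set.disjoint_left.1 h (show i % orderOf α ∈ _ from ⟨0, by simp⟩) ?_
  rw [← aeval_minpoly_pow hlt, ← heq, aeval_minpoly_pow hlt]
  exact ⟨0, by simp⟩

/-- The extension is separable and normal, so the degree counts the conjugates of `α ^ i`. -/
theorem natDegree_minpoly_pow (hα : 0 < orderOf α) (i : ℕ) :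
    (minpoly F (α ^ i)).natDegree = (qCoset (Fintype.card F) (orderOf α) i).ncard := by
  have hint : IsIntegral F (α ^ i) := Algebra.IsIntegral.isIntegral _
  have hlt : ∀ t ∈ qCoset (Fintype.card F) (orderOf α) i, t < orderOf α := by
    rintro _ ⟨j, rfl⟩
    exact Nat.mod_lt _ hα
  have hroots : (minpoly F (α ^ i)).rootSet K =
      (α ^ ·) '' qCoset (Fintype.card F) (orderOf α) i := by
    ext x
    rw [← isConjRoot_iff_mem_minpoly_rootSet hint]
    constructor
    · intro hx
      obtain ⟨j, rfl⟩ := isConjRoot_iff_exists_pow.1 hx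
      exact ⟨_, ⟨j, rfl⟩, by simp only [pow_mod_orderOf, pow_mul]⟩
    · rintro ⟨t, ht, rfl⟩
      exact (isConjRoot_pow_iff (hlt t ht)).2 ht
  rw [← card_rootSet_eq_natDegree (Algebra.IsSeparable.isSeparable F (α ^ i))
    (Normal.splits inferInstance (α ^ i)), ← Nat.card_eq_fintype_card, Nat.card_coe_set_eq, hroots]
  exact Set.InjOn.ncard_image fun s hs t ht h =>
    pow_injOn_Iio_orderOf (hlt s hs) (hlt t ht) h

theorem natDegree_prod_minpolys (hα : 0 < orderOf α) {S : Finset ℕ}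
    (hS : (S : Set ℕ).PairwiseDisjoint (qCoset (Fintype.card F) (orderOf α))) :
    (∏ p ∈ minpolys F α S, p).natDegree =
      ∑ i ∈ S, (qCoset (Fintype.card F) (orderOf α) i).ncard := by
  classical
  have hinj : Set.InjOn (fun i => minpoly F (α ^ i)) S := by
    intro i hi j hj hij
    by_contra hne
    exact minpoly_pow_ne_of_disjoint hα (hS hi hj hne) hij
  rw [natDegree_prod_of_monic]
  · rw [minpolys, Finset.sum_congr (by congr) fun _ _ => rfl, Finset.sum_image hinj]
    exact Finset.sum_congr rfl fun i _ => natDegree_minpoly_pow hα i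
  · intro p hp
    obtain ⟨i, -, rfl⟩ := mem_minpolys.1 hp
    exact minpoly.monic (Algebra.IsIntegral.isIntegral _)

/-- By disjointness, no factor of the BCH generator is among those omitted from the generator of
`coCode`. -/
theorem coCode_le_bchCode (hα : 0 < orderOf α) {T : Finset ℕ} {b δ : ℕ}
    (hT : ∀ i ∈ Finset.Ico b (b + δ - 1), ∀ j ∈ T,
      Disjoint (qCoset (Fintype.card F) (orderOf α) i) (qCoset (Fintype.card F) (orderOf α) j)) :
    coCode F (orderOf α) α T ≤ bchCode F (orderOf α) α b δ := by
  classical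
  intro c hc
  refine dvd_trans (Finset.prod_dvd_prod_of_subset _ _ _ fun p hp => ?_) hc
  refine Finset.mem_sdiff.2 ⟨minpolys_subset_range hα _ hp, fun hpT => ?_⟩
  obtain ⟨i, hi, rfl⟩ := mem_minpolys.1 hp
  obtain ⟨j, hj, hij⟩ := mem_minpolys.1 hpT
  exact minpoly_pow_ne_of_disjoint hα (hT i hi j hj) hij.symm

theorem finrank_bchCode (hα : 0 < orderOf α) {b δ : ℕ}
    (hS : (Finset.Ico b (b + δ - 1) : Set ℕ).PairwiseDisjoint
      (qCoset (Fintype.card F) (orderOf α))) :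
    Module.finrank F (bchCode F (orderOf α) α b δ) + ∑ i ∈ Finset.Ico b (b + δ - 1),
      (qCoset (Fintype.card F) (orderOf α) i).ncard = orderOf α := by
  have hmonic : (bchGenerator F α b δ).Monic := monic_prod_of_subset_minpolys subset_rfl
  have hle : (bchGenerator F α b δ).natDegree ≤ orderOf α := by
    have hdvd : bchGenerator F α b δ ∣ X ^ orderOf α - 1 := by
      rw [← prod_minpolys_range (F := F) hα]
      exact Finset.prod_dvd_prod_of_subset _ _ _ (minpolys_subset_range hα _)
    refine (natDegree_le_of_dvd hdvd ?_).trans_eq ?_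
    · rw [← C_1]
      exact X_pow_sub_C_ne_zero hα _
    · rw [← C_1, natDegree_X_pow_sub_C]
  rw [← natDegree_prod_minpolys hα hS, bchCode, finrank_cyclicCode hmonic hle]
  exact Nat.sub_add_cancel hle

theorem finrank_coCode (hα : 0 < orderOf α) {b δ : ℕ}
    (hS : (Finset.Ico b (b + δ - 1) : Set ℕ).PairwiseDisjoint
      (qCoset (Fintype.card F) (orderOf α))) :
    Module.finrank F (coCode F (orderOf α) α (Finset.Ico b (b + δ - 1))) =
      ∑ i ∈ Finset.Ico b (b + δ - 1), (qCoset (Fintype.card F) (orderOf α) i).ncard := by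
  have h := finrank_euclideanDual (coCode F (orderOf α) α (Finset.Ico b (b + δ - 1)))
  rw [euclideanDual_coCode hα, finrank_reverseCode] at h
  have h1 := finrank_bchCode hα hS
  have h2 := Submodule.finrank_le (coCode F (orderOf α) α (Finset.Ico b (b + δ - 1)))
  rw [Module.finrank_fin_fun] at h2
  omega

end

/-! ### Cosets modulo `q ^ 2 - 1` via base `q` digits -/

section

variable {q : ℕ}

theorem digits_inj {a b c d : ℕ} (hb : b < q) (hd : d < q) (h : a * q + b = c * q + d) :
    a = c ∧ b = d := by
  have h1 := congrArg (· % q) h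
  simp only [Nat.mul_add_mod', Nat.mod_eq_of_lt hb, Nat.mod_eq_of_lt hd] at h1
  subst h1
  exact ⟨Nat.eq_of_mul_eq_mul_right (by omega) (Nat.add_right_cancel h), rfl⟩

/-- Among two-digit numbers the bound excludes only the one with both digits `q - 1`, which the swap
fixes. -/
theorem digits_swap_lt {a b : ℕ} (hb : b < q) (h : a * q + b < q ^ 2 - 1) :
    a < q ∧ b * q + a < q ^ 2 - 1 := by
  have ha : a < q := by
    by_contra! hcon
    have := Nat.mul_le_mul_right q hcon
    rw [sq] at h
    omega
  refine ⟨ha, ?_⟩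
  obtain ⟨r, rfl⟩ : ∃ r, q = r + 1 := ⟨q - 1, by omega⟩
  have hr : (r + 1) ^ 2 - 1 = r * (r + 1) + r := by
    rw [show (r + 1) ^ 2 = r * (r + 1) + r + 1 by ring, Nat.add_sub_cancel]
  rw [hr] at h ⊢
  rcases (Nat.lt_succ_iff.1 hb).lt_or_eq with hb' | rfl
  · have := Nat.mul_le_mul_right (r + 1) (Nat.succ_le_of_lt hb')
    rw [Nat.succ_mul] at this
    omega
  · have : a ≠ b := by
      rintro rfl
      omega
    omega

/-- The `q`-coset modulo `q ^ 2 - 1` swaps the two base `q` digits. -/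
theorem qCoset_digits {a b : ℕ} (hb : b < q) (h : a * q + b < q ^ 2 - 1) :
    qCoset q (q ^ 2 - 1) (a * q + b) = {a * q + b, b * q + a} := by
  -- This is `q ^ 2 ≡ 1` modulo `q ^ 2 - 1`.
  have hswap : ∀ c d : ℕ, d < q → c * q + d < q ^ 2 - 1 →
      (c * q + d) * q % (q ^ 2 - 1) = d * q + c := by
    intro c d hd hcd
    have h2 : q ^ 2 - 1 + 1 = q ^ 2 := by omega
    have : (c * q + d) * q = d * q + c + (q ^ 2 - 1) * c := by
      calc (c * q + d) * q = d * q + q ^ 2 * c := by ring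
        _ = d * q + (q ^ 2 - 1 + 1) * c := by rw [h2]
        _ = _ := by ring
    rw [this, Nat.add_mul_mod_self_left, Nat.mod_eq_of_lt (digits_swap_lt hd hcd).2]
  obtain ⟨ha, h'⟩ := digits_swap_lt hb h
  have hj : ∀ j, (a * q + b) * q ^ (2 * j) % (q ^ 2 - 1) = a * q + b ∧
      (a * q + b) * q ^ (2 * j + 1) % (q ^ 2 - 1) = b * q + a := by
    intro j
    induction j with
    | zero => exact ⟨by simpa using Nat.mod_eq_of_lt h, by simpa using hswap a b hb h⟩
    | succ j ih =>
      have h1 : (a * q + b) * q ^ (2 * (j + 1)) % (q ^ 2 - 1) = a * q + b := by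
        rw [show 2 * (j + 1) = 2 * j + 1 + 1 by ring, pow_succ, ← mul_assoc, ← Nat.mod_mul_mod, ih.2,
          hswap b a ha h']
      refine ⟨h1, ?_⟩
      rw [pow_succ, ← mul_assoc, ← Nat.mod_mul_mod, h1, hswap a b hb h]
  ext t
  simp only [qCoset, Set.mem_ofPred_eq, Set.mem_insert_iff, Set.mem_singleton_iff]
  constructor
  · rintro ⟨j, rfl⟩
    obtain ⟨i, rfl | rfl⟩ := j.even_or_odd'
    · exact Or.inl (hj i).1
    · exact Or.inr (hj i).2
  · rintro (rfl | rfl)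
    · exact ⟨2 * 0, (hj 0).1.symm⟩
    · exact ⟨2 * 0 + 1, (hj 0).2.symm⟩

theorem ncard_qCoset_digits {a b : ℕ} (hb : b < q) (h : a * q + b < q ^ 2 - 1) (hab : a ≠ b) :
    (qCoset q (q ^ 2 - 1) (a * q + b)).ncard = 2 := by
  rw [qCoset_digits hb h, Set.ncard_pair]
  exact fun h' => hab (digits_inj hb (digits_swap_lt hb h).1 h').1

theorem disjoint_qCoset_digits {a b c d : ℕ} (hb : b < q) (hab : a * q + b < q ^ 2 - 1)
    (hd : d < q) (hcd : c * q + d < q ^ 2 - 1) (h1 : ¬(a = c ∧ b = d)) (h2 : ¬(a = d ∧ b = c)) :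
    Disjoint (qCoset q (q ^ 2 - 1) (a * q + b)) (qCoset q (q ^ 2 - 1) (c * q + d)) := by
  have ha := (digits_swap_lt hb hab).1
  have hc := (digits_swap_lt hd hcd).1
  rw [qCoset_digits hb hab, qCoset_digits hd hcd, Set.disjoint_left]
  simp only [Set.mem_insert_iff, Set.mem_singleton_iff]
  rintro t (rfl | rfl) (h | h)
  · exact h1 (digits_inj hb hd h)
  · exact h2 (digits_inj hb hc h)
  · exact h2 (digits_inj ha hd h).symm
  · exact h1 (digits_inj ha hc h).symm

theorem two_mul_lt_sq_sub_one (hq : 3 ≤ q) : 2 * q < q ^ 2 - 1 := by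
  have := Nat.mul_le_mul_right q hq
  rw [← sq] at this
  omega

theorem qCoset_of_lt (hq : 3 ≤ q) {i : ℕ} (hi : i < q) :
    qCoset q (q ^ 2 - 1) i = {i, i * q} := by
  have := two_mul_lt_sq_sub_one hq
  simpa using qCoset_digits (a := 0) hi (by omega)

theorem qCoset_add (hq : 3 ≤ q) {l : ℕ} (hl : l < q) :
    qCoset q (q ^ 2 - 1) (q + l) = {q + l, 1 + l * q} := by
  have := two_mul_lt_sq_sub_one hq
  simpa [add_comm 1] using qCoset_digits (a := 1) hl (by omega)

theorem ncard_qCoset_of_lt (hq : 3 ≤ q) {i : ℕ} (h0 : i ≠ 0) (hi : i < q) :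
    (qCoset q (q ^ 2 - 1) i).ncard = 2 := by
  have := two_mul_lt_sq_sub_one hq
  simpa using ncard_qCoset_digits (a := 0) hi (by omega) h0.symm

theorem ncard_qCoset_add (hq : 3 ≤ q) {l : ℕ} (h1 : l ≠ 1) (hl : l < q) :
    (qCoset q (q ^ 2 - 1) (q + l)).ncard = 2 := by
  have := two_mul_lt_sq_sub_one hq
  simpa using ncard_qCoset_digits (a := 1) hl (by omega) h1.symm

/-- The digit pairs are `(0, b)` and `(1, b)` with `b ≠ 0`. Two distinct ones could be swaps of each
other only as `(0, 1)` and `(1, 0)`; the latter is the omitted `q`. -/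
theorem pairwiseDisjoint_qCoset (hq : 3 ≤ q) :
    (Set.Icc 0 (q - 2) ∪ Set.Icc (q + 1) (2 * q - 1)).PairwiseDisjoint
      (qCoset q (q ^ 2 - 1)) := by
  have hn := two_mul_lt_sq_sub_one hq
  have hdigits : ∀ s ∈ Set.Icc 0 (q - 2) ∪ Set.Icc (q + 1) (2 * q - 1),
      ∃ a b, s = a * q + b ∧ b < q ∧ s < q ^ 2 - 1 ∧ (a = 0 ∨ a = 1 ∧ b ≠ 0) := by
    rintro s (hs | hs) <;> rw [Set.mem_Icc] at hs
    · exact ⟨0, s, by omega, by omega, by omega, Or.inl rfl⟩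
    · exact ⟨1, s - q, by omega, by omega, by omega, Or.inr ⟨rfl, by omega⟩⟩
  intro s hs t ht hst
  obtain ⟨a, b, rfl, hb, hab, ha⟩ := hdigits s hs
  obtain ⟨c, d, rfl, hd, hcd, hc⟩ := hdigits t ht
  refine disjoint_qCoset_digits hb hab hd hcd ?_ ?_
  · rintro ⟨rfl, rfl⟩
    exact hst rfl
  · rintro ⟨rfl, rfl⟩
    obtain rfl | ⟨rfl, h⟩ := ha <;> obtain rfl | ⟨rfl, h'⟩ := hc <;> simp_all

theorem sum_ncard_qCoset_zero (hq : 3 ≤ q) :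
    ∑ i ∈ Finset.Ico 0 (0 + q - 1), (qCoset q (q ^ 2 - 1) i).ncard = 2 * q - 3 := by
  rw [Finset.sum_eq_sum_Ico_succ_bot (by omega), Finset.sum_const_nat (m := 2) fun i hi => ?_,
    qCoset_of_lt hq (by omega)]
  · simp
    omega
  · rw [Finset.mem_Ico] at hi
    exact ncard_qCoset_of_lt hq (by omega) (by omega)

/-- The bottom index `q + 1` has equal digits and contributes one element; the other `q - 2` indices
contribute two each. -/
theorem sum_ncard_qCoset_add_one (hq : 3 ≤ q) :
    ∑ i ∈ Finset.Ico (q + 1) (q + 1 + q - 1), (qCoset q (q ^ 2 - 1) i).ncard = 2 * q - 3 := by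
  rw [Finset.sum_eq_sum_Ico_succ_bot (by omega), Finset.sum_const_nat (m := 2) fun i hi => ?_,
    qCoset_add hq (by omega)]
  · simp [add_comm 1 q]
    omega
  · rw [Finset.mem_Ico] at hi
    rw [show i = q + (i - q) by omega]
    exact ncard_qCoset_add hq (by omega) (by omega)

end

/-! ### Parameters of the quantum code -/

section

variable {F K : Type*} [Field F] [Fintype F] [Field K] [Algebra F K]

theorem orderOf_primitive (h2 : Module.finrank F K = 2) {α : Kˣ}
    (hα : ∀ x : Kˣ, x ∈ Subgroup.zpowers α) :
    orderOf (α : K) = Fintype.card F ^ 2 - 1 := by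
  have : Module.Finite F K := Module.finite_of_finrank_pos (by omega)
  have : Finite K := Module.finite_of_finite F
  have : Fintype K := Fintype.ofFinite K
  rw [orderOf_units, orderOf_eq_card_of_forall_mem_zpowers hα, Nat.card_units,
    Module.natCard_eq_pow_finrank (K := F), h2, Nat.card_eq_fintype_card]

theorem bch_css_parameters [DecidableEq F] {q : ℕ} (hq : 3 ≤ q) (hF : Fintype.card F = q)
    (h2 : Module.finrank F K = 2) {α : Kˣ} (hα : ∀ x : Kˣ, x ∈ Subgroup.zpowers α) :
    (∀ t < q ^ 2 - 1, aeval ((α : K) ^ t) (bchGenerator F (α : K) 0 q) = 0 ↔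
      ∃ i ∈ Finset.Icc 0 (q - 2), t ∈ qCoset q (q ^ 2 - 1) i) ∧
    (∀ t < q ^ 2 - 1, aeval ((α : K) ^ t) (bchGenerator F (α : K) (q + 1) q) = 0 ↔
      ∃ i ∈ Finset.Icc (q + 1) (2 * q - 1), t ∈ qCoset q (q ^ 2 - 1) i) ∧
    euclideanDual (coCode F (q ^ 2 - 1) (α : K) (Finset.Icc (q + 1) (2 * q - 1))) =
      reverseCode (bchCode F (q ^ 2 - 1) (α : K) (q + 1) q) ∧
    coCode F (q ^ 2 - 1) (α : K) (Finset.Icc (q + 1) (2 * q - 1)) ≤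
      bchCode F (q ^ 2 - 1) (α : K) 0 q ∧
    ∃ d : ℕ, q ≤ d ∧
      IsQuantumCode
        (cssCode (bchCode F (q ^ 2 - 1) (α : K) 0 q)
          (coCode F (q ^ 2 - 1) (α : K) (Finset.Icc (q + 1) (2 * q - 1))))
        (q ^ 2 + 5 - 4 * q) d := by
  have : Module.Finite F K := Module.finite_of_finrank_pos (by omega)
  have : Finite K := Module.finite_of_finite F
  have hn := two_mul_lt_sq_sub_one hq
  have hord : orderOf (α : K) = q ^ 2 - 1 := hF ▸ orderOf_primitive h2 hα
  have hpos : 0 < orderOf (α : K) := by omega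
  have hdisj := pairwiseDisjoint_qCoset hq
  have hT : Finset.Icc (q + 1) (2 * q - 1) = Finset.Ico (q + 1) (q + 1 + q - 1) := by
    ext i
    simp only [Finset.mem_Icc, Finset.mem_Ico]
    omega
  have hZ : Finset.Icc 0 (q - 2) = Finset.Ico 0 (0 + q - 1) := by
    ext i
    simp only [Finset.mem_Icc, Finset.mem_Ico]
    omega
  have hdisjZ : (Finset.Ico 0 (0 + q - 1) : Set ℕ).PairwiseDisjoint (qCoset q (q ^ 2 - 1)) := by
    rw [← hZ, Finset.coe_Icc]
    exact hdisj.subset Set.subset_union_left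
  have hdisjT : (Finset.Ico (q + 1) (q + 1 + q - 1) : Set ℕ).PairwiseDisjoint
      (qCoset q (q ^ 2 - 1)) := by
    rw [← hT, Finset.coe_Icc]
    exact hdisj.subset Set.subset_union_right
  have hdual := euclideanDual_coCode (F := F) hpos (q + 1) q
  have hle : coCode F (q ^ 2 - 1) (α : K) (Finset.Icc (q + 1) (2 * q - 1)) ≤
      bchCode F (q ^ 2 - 1) (α : K) 0 q := by
    rw [← hord]
    refine coCode_le_bchCode hpos fun i hi j hj => ?_
    rw [hord, hF]
    rw [← hZ, Finset.mem_Icc] at hi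
    rw [Finset.mem_Icc] at hj
    exact hdisj (Or.inl hi) (Or.inr hj) (by omega)
  have hdim₁ := finrank_bchCode (F := F) hpos (b := 0) (δ := q) (by rwa [hord, hF])
  have hdim₂ := finrank_coCode (F := F) hpos (b := q + 1) (δ := q) (by rwa [hord, hF])
  rw [hord, ← hT] at hdual
  rw [hord, hF, sum_ncard_qCoset_zero hq] at hdim₁
  rw [hord, hF, sum_ncard_qCoset_add_one hq, ← hT] at hdim₂
  refine ⟨fun t ht => ?_, fun t ht => ?_, hdual, hle,
    exists_isQuantumCode_cssCode hle ?_ ?_ (fun x hx h0 => ?_) fun x hx h0 => ?_⟩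
  · rw [aeval_bchGenerator (hord ▸ ht), hord, hF, hZ]
  · rw [aeval_bchGenerator (hord ▸ ht), hord, hF, hT]
  -- With `q = 3 + r` the exponent is `r² + 2r + 2`, hence nonzero.
  · have := Nat.mul_le_mul_right q hq
    obtain ⟨r, rfl⟩ := Nat.exists_eq_add_of_le hq
    have : (3 + r) ^ 2 = 9 + 6 * r + r ^ 2 := by ring
    omega
  · obtain ⟨r, rfl⟩ := Nat.exists_eq_add_of_le hq
    have : (3 + r) ^ 2 = 9 + 6 * r + r ^ 2 := by ring
    omega
  · exact le_hammingNorm_of_mem_bchCode α.ne_zero hord.ge hx h0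
  · rw [hdual] at hx
    obtain ⟨y, hy, rfl⟩ := hx
    refine (le_hammingNorm_of_mem_bchCode α.ne_zero hord.ge hy fun h => h0 ?_).trans_eq
      (hammingNorm_comp_rev y).symm
    rw [h, map_zero]

theorem exists_quadratic_extension (F : Type*) [Field F] [Finite F] :
    ∃ (K : Type) (_ : Field K) (_ : Algebra F K) (α : Kˣ), Module.finrank F K = 2 ∧
      ∀ x : Kˣ, x ∈ Subgroup.zpowers α := by
  obtain ⟨p, hp⟩ := CharP.exists F
  have : Fact p.Prime := ⟨CharP.char_is_prime F p⟩
  obtain ⟨α, hα⟩ := IsCyclic.exists_generator (α := (FiniteField.Extension F p 2)ˣ)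
  exact ⟨_, _, _, α, FiniteField.finrank_extension F p 2, hα⟩

theorem exists_bch_quantumCode (A : Type*) [Fintype A] [DecidableEq A]
    (hA : IsPrimePow (Fintype.card A)) {q : ℕ} (hq : 3 ≤ q) (hAq : Fintype.card A = q) :
    ∃ d : ℕ, q ≤ d ∧ ∃ Q : Submodule ℂ (QuditSpace A (q ^ 2 - 1)),
      IsQuantumCode Q (q ^ 2 + 5 - 4 * q) d := by
  -- The definition of a quantum code uses no algebra on the alphabet, so any field structure may be
  -- chosen.
  obtain ⟨_⟩ := Fintype.nonempty_field_iff.2 hA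
  obtain ⟨K, _, _, α, h2, hα⟩ := exists_quadratic_extension A
  obtain ⟨d, hd, hQ⟩ := (bch_css_parameters hq hAq h2 hα).2.2.2.2
  exact ⟨d, hd, _, hQ⟩

end

end QBCH

end

/-- The natural number `q ^ 2 + 5 - 4 * q` is `q² - 4q + 5 = (q - 2)² + 1`, written so that the
subtraction does not truncate. -/
theorem mainTheorem3 (q : ℕ) (hq : IsPrimePow q) (hq3 : 3 ≤ q) :
    -- existence of the quantum codes
    (∃ d : ℕ, q ≤ d ∧ ∃ Q : Submodule ℂ (QBCH.QuditSpace (Fin q) (q ^ 2 - 1)),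
      QBCH.IsQuantumCode Q (q ^ 2 + 5 - 4 * q) d) ∧
    -- the cosets involved
    (QBCH.qCoset q (q ^ 2 - 1) 0 = {0} ∧
      (∀ i ∈ Finset.Icc 1 (q - 2),
        QBCH.qCoset q (q ^ 2 - 1) i = {i, i * q} ∧ (QBCH.qCoset q (q ^ 2 - 1) i).ncard = 2) ∧
      QBCH.qCoset q (q ^ 2 - 1) (q + 1) = {q + 1} ∧
      (∀ l ∈ Finset.Icc 2 (q - 1),
        QBCH.qCoset q (q ^ 2 - 1) (q + l) = {q + l, 1 + l * q} ∧
        (QBCH.qCoset q (q ^ 2 - 1) (q + l)).ncard = 2) ∧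
      (Set.Icc 0 (q - 2) ∪ Set.Icc (q + 1) (2 * q - 1)).PairwiseDisjoint
        (QBCH.qCoset q (q ^ 2 - 1))) ∧
    -- the codes come from the CSS construction applied to BCH codes
    (∀ (F : Type*) (K : Type*) [Field F] [Fintype F] [DecidableEq F] [Field K] [Algebra F K]
      (α : Kˣ), Fintype.card F = q → Module.finrank F K = 2 →
      (∀ x : Kˣ, x ∈ Subgroup.zpowers α) →
      -- defining sets of the two BCH codes
      (∀ t < q ^ 2 - 1, aeval ((α : K) ^ t) (QBCH.bchGenerator F (α : K) 0 q) = 0 ↔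
        ∃ i ∈ Finset.Icc 0 (q - 2), t ∈ QBCH.qCoset q (q ^ 2 - 1) i) ∧
      (∀ t < q ^ 2 - 1, aeval ((α : K) ^ t) (QBCH.bchGenerator F (α : K) (q + 1) q) = 0 ↔
        ∃ i ∈ Finset.Icc (q + 1) (2 * q - 1), t ∈ QBCH.qCoset q (q ^ 2 - 1) i) ∧
      -- the dual of the second code is equivalent to a BCH code
      QBCH.euclideanDual (QBCH.coCode F (q ^ 2 - 1) (α : K) (Finset.Icc (q + 1) (2 * q - 1))) =
        QBCH.reverseCode (QBCH.bchCode F (q ^ 2 - 1) (α : K) (q + 1) q) ∧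
      -- the two codes are nested, and their CSS code has the stated parameters
      QBCH.coCode F (q ^ 2 - 1) (α : K) (Finset.Icc (q + 1) (2 * q - 1)) ≤
        QBCH.bchCode F (q ^ 2 - 1) (α : K) 0 q ∧
      ∃ d : ℕ, q ≤ d ∧
        QBCH.IsQuantumCode
          (QBCH.cssCode (QBCH.bchCode F (q ^ 2 - 1) (α : K) 0 q)
            (QBCH.coCode F (q ^ 2 - 1) (α : K) (Finset.Icc (q + 1) (2 * q - 1))))
          (q ^ 2 + 5 - 4 * q) d) := by
  refine ⟨?_, ⟨?_, ?_, ?_, ?_, QBCH.pairwiseDisjoint_qCoset hq3⟩, ?_⟩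
  · exact QBCH.exists_bch_quantumCode (Fin q) (by simpa using hq) hq3 (Fintype.card_fin q)
  · simpa using QBCH.qCoset_of_lt hq3 (i := 0) (by omega)
  · intro i hi
    rw [Finset.mem_Icc] at hi
    exact ⟨QBCH.qCoset_of_lt hq3 (by omega), QBCH.ncard_qCoset_of_lt hq3 (by omega) (by omega)⟩
  · simpa [add_comm 1 q] using QBCH.qCoset_add hq3 (l := 1) (by omega)
  · intro l hl
    rw [Finset.mem_Icc] at hl
    exact ⟨QBCH.qCoset_add hq3 (by omega), QBCH.ncard_qCoset_add hq3 (by omega) (by omega)⟩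
  · intro F K _ _ _ _ _ α hF h2 hα
    exact QBCH.bch_css_parameters hq3 hF h2 hα
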